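/- Let $\mathbb D=\{z\in\mathbb C:|z|<1\}$, let $\mathbb T=\partial\mathbb D$ carry the normalized arc length measure $m$, and let $L^p=L^p(\mathbb T,m)$ (complex-valued functions, identified when they agree a.e.). For $f\in L^1$ let $$\mathcal Pf(z)=\int_{\mathbb T}f(\zeta)\,\frac{1-|z|^2}{|\zeta-z|^2}\,dm(\zeta),\qquad z\in\mathbb D,$$ be its Poisson integral. For $1\le p\le\infty$ let $H^p$ be the set of all $f\in L^p$ for which $\mathcal Pf$ is analytic on $\mathbb D$; a function $f\in H^p$ is identified with its analytic extension $\mathcal Pf$ to $\mathbb D$. For $f\in L^2$ put $$\Phi_f(z)=\mathcal P(|f|^2)(z)-|\mathcal Pf(z)|^2\quad(z\in\mathbb D),\qquad \|f\|_G=\sup_{z\in\mathbb D}\Phi_f(z)^{1/2}.$$ Let $\mathrm{BMO}$ be the set of all $f\in L^2$ for which $\Phi_f$ is bounded on $\mathbb D$; let $\mathrm{BMO}_{\mathrm{na}}$ be the set of all $f\in\mathrm{BMO}$ such that $\sup_{z\in\mathbb D}\Phi_f(z)=\Phi_f(z_0)$ for some $z_0\in\mathbb D$; let $\mathrm{VMO}$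 be the set of all $f\in\mathrm{BMO}$ with $\Phi_f(z)\to0$ as $|z|\to1^-$; and let $QA=\mathrm{VMO}\cap H^2\cap H^\infty$. A function $f\in L^\infty$ is called $G$-extremal if $\|f\|_G=\|f\|_\infty$. An inner function is an $I\in H^\infty$ with $|I|=1$ a.e. on $\mathbb T$. A finite Blaschke product is a finite (possibly empty) product of factors $\frac{|a|}{a}\,\frac{a-z}{1-\bar a z}$ with $a\in\mathbb D$, where $|a|/a$ is read as $-1$ if $a=0$. (1) A function $f$ belongs to $\mathrm{BMO}_{\mathrm{na}}\cap H^\infty$ and is $G$-extremal if and only if $f=cI$ for some $c\in\mathbb C$ and some inner function $I$ that has a zero in $\mathbb D$. (2) A function $f$ belongs to $QA$ and is $G$-extremal if and only if $f=cB$ for some $c\in\mathbb C$ and some nonconstant finite Blaschke product $B$. -/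

import Mathlib

open MeasureTheory Metric Filter
open scoped Topology ENNReal

noncomputable section

namespace Garsia

instance circleMeasurableSpace : MeasurableSpace Circle := borel Circle

instance circleBorelSpace : BorelSpace Circle := ⟨rfl⟩

/-- Normalized arc length on the unit circle: the image of the Haar probability measure of `ℝ / ℤ`
under `t ↦ exp (2 π i t)`. -/
def arcMeasure : Measure Circle :=
  (AddCircle.haarAddCircle : Measure UnitAddCircle).map AddCircle.toCircle

instance isProbabilityMeasure_arcMeasure : IsProbabilityMeasure arcMeasure :=
  Measure.isProbabilityMeasure_map AddCircle.continuous_toCircle.measurable.aemeasurable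

/-- The Poisson integral at a point `z` of the open unit disk `ball 0 1`, that is, the integral
of `f` against the harmonic measure with density `(1 - |z|²) / |ζ - z|²`. It is used both for
complex-valued and for real-valued `f`. -/
def poissonIntegral {E : Type*} [NormedAddCommGroup E] [NormedSpace ℝ E]
    (f : Circle → E) (z : ℂ) : E :=
  ∫ ζ : Circle, ((1 - ‖z‖ ^ 2) / ‖(ζ : ℂ) - z‖ ^ 2) • f ζ ∂arcMeasure

/-- `Φ_f = P(|f|²) - |P f|²`, for `f` in `L²`. -/
def oscillation (f : Circle → ℂ) (z : ℂ) : ℝ :=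
  poissonIntegral (fun ζ => ‖f ζ‖ ^ 2) z - ‖poissonIntegral f z‖ ^ 2

/-- The Garsia norm, the supremum of `Φ_f ^ (1 / 2)` over the disk, as an extended
nonnegative real. -/
def garsiaNorm (f : Circle → ℂ) : ℝ≥0∞ :=
  ⨆ z ∈ ball (0 : ℂ) 1, ENNReal.ofReal √(oscillation f z)

/-- The functions of bounded mean oscillation. Here and below, the elements of function spaces are
functions on the circle, which are identified when they agree almost everywhere; all the conditions
depend only on the class. -/
def BMO : Set (Circle → ℂ) :=
  {f | MemLp f 2 arcMeasure ∧ BddAbove (oscillation f '' ball (0 : ℂ) 1)}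

/-- The norm-attaining functions in `BMO`: `Φ_f` attains its supremum in the disk. -/
def BMOna : Set (Circle → ℂ) :=
  {f | f ∈ BMO ∧ ∃ z₀ ∈ ball (0 : ℂ) 1, ∀ z ∈ ball (0 : ℂ) 1, oscillation f z ≤ oscillation f z₀}

/-- The functions of vanishing mean oscillation: `Φ_f z → 0` as `|z| → 1⁻`. -/
def VMO : Set (Circle → ℂ) :=
  {f | f ∈ BMO ∧ Tendsto (oscillation f) (comap norm (𝓝[<] (1 : ℝ))) (𝓝 0)}

/-- The Hardy space `H^p` (for `1 ≤ p ≤ ∞`), as a space of functions on the circle. -/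
def Hardy (p : ℝ≥0∞) : Set (Circle → ℂ) :=
  {f | MemLp f p arcMeasure ∧ AnalyticOnNhd ℂ (poissonIntegral f) (ball (0 : ℂ) 1)}

def VMOA : Set (Circle → ℂ) := VMO ∩ Hardy 2

def QA : Set (Circle → ℂ) := VMOA ∩ Hardy ∞

/-- A function in `L^∞` is `G`-extremal if its Garsia norm equals its `L^∞` norm. -/
def IsGExtremal (f : Circle → ℂ) : Prop :=
  MemLp f ∞ arcMeasure ∧ garsiaNorm f = eLpNorm f ∞ arcMeasure

/-- Inner functions: functions in `H^∞` which are unimodular almost everywhere on the circle. -/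
def IsInner (f : Circle → ℂ) : Prop :=
  f ∈ Hardy ∞ ∧ ∀ᵐ ζ ∂arcMeasure, ‖f ζ‖ = 1

/-- A single factor `(|a| / a) (a - z) / (1 - conj a * z)` of a Blaschke product; the factor
`|a| / a` is read as `-1` for `a = 0`. -/
def blaschkeFactor (a z : ℂ) : ℂ :=
  (if a = 0 then -1 else (‖a‖ : ℂ) / a) * ((a - z) / (1 - starRingEnd ℂ a * z))

/-- Finite Blaschke products, as rational functions; zeros may be repeated, and the empty
product `1` is allowed. -/
def IsFiniteBlaschkeProduct (B : ℂ → ℂ) : Prop :=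
  ∃ (n : ℕ) (a : Fin n → ℂ), (∀ j, a j ∈ ball (0 : ℂ) 1) ∧
    B = fun z => ∏ j, blaschkeFactor (a j) z

end Garsia

end

namespace Garsia

/-! Let `M` be the `L^∞` norm of `f`. Since `P(|f|²) ≤ M²`, a point where `Φ_f = M²` forces `Pf = 0`
there and, by positivity of the Poisson kernel, `|f| = M` a.e.; so `f` is `M` times an inner
function with a zero. Conversely `Φ_{cI} = |c|²(1 - |PI|²)` (`oscillation_const_mul_of_norm_eq_one`)
is maximal exactly at the zeros of `I` once there are any, unless `c = 0`. This gives (1).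

For (2), a VMO function with nonzero Garsia norm attains it by compactness (`mem_BMOna_of_mem_VMO`),
so (1) gives `f = cI`. Vanishing of `Φ_f` at the boundary then says `|PI| → 1`, and an analytic
function with this property is a constant times a finite Blaschke product
(`exists_finiteBlaschkeProduct`). Equality inside the disk passes to boundary values because an `L²`
function is determined by its Poisson integral (`ae_eq_zero_of_poissonIntegral`). -/

/-! ### The Poisson kernel and Poisson integrals. -/

/-- The Poisson kernel of the unit disk. -/
noncomputable def diskKernel (z : ℂ) (ζ : Circle) : ℝ :=
  (1 - ‖z‖ ^ 2) / ‖(ζ : ℂ) - z‖ ^ 2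

lemma poissonIntegral_eq {E : Type*} [NormedAddCommGroup E] [NormedSpace ℝ E]
    (f : Circle → E) (z : ℂ) :
    poissonIntegral f z = ∫ ζ : Circle, diskKernel z ζ • f ζ ∂arcMeasure := rfl

lemma coe_sub_ne_zero {z : ℂ} (hz : z ∈ ball (0 : ℂ) 1) (ζ : Circle) : (ζ : ℂ) - z ≠ 0 := by
  intro h
  have h1 : ‖(ζ : ℂ)‖ = ‖z‖ := by rw [sub_eq_zero.1 h]
  rw [Circle.norm_coe] at h1
  rw [mem_ball_zero_iff] at hz
  linarith

lemma diskKernel_pos {z : ℂ} (hz : z ∈ ball (0 : ℂ) 1) (ζ : Circle) : 0 < diskKernel z ζ := by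
  have h := norm_pos_iff.2 (coe_sub_ne_zero hz ζ)
  rw [mem_ball_zero_iff] at hz
  have : 0 < 1 - ‖z‖ ^ 2 := by nlinarith [norm_nonneg z]
  unfold diskKernel
  positivity

lemma diskKernel_le {z : ℂ} {ρ : ℝ} (hρ : ρ < 1) (hz : ‖z‖ ≤ ρ) (ζ : Circle) :
    diskKernel z ζ ≤ 1 / (1 - ρ) ^ 2 := by
  have h1 : 1 - ρ ≤ ‖(ζ : ℂ) - z‖ := by
    have := norm_sub_norm_le (ζ : ℂ) z
    rw [Circle.norm_coe] at this
    linarith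
  have h2 : 0 < 1 - ρ := by linarith
  unfold diskKernel
  gcongr
  nlinarith [norm_nonneg z]

lemma norm_diskKernel_le {z : ℂ} {ρ : ℝ} (hρ : ρ < 1) (hz : ‖z‖ ≤ ρ) (ζ : Circle) :
    ‖diskKernel z ζ‖ ≤ 1 / (1 - ρ) ^ 2 := by
  rw [Real.norm_of_nonneg (diskKernel_pos (mem_ball_zero_iff.2 (hz.trans_lt hρ)) ζ).le]
  exact diskKernel_le hρ hz ζ

lemma continuous_diskKernel {z : ℂ} (hz : z ∈ ball (0 : ℂ) 1) : Continuous (diskKernel z) := by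
  unfold diskKernel
  refine continuous_const.div (by fun_prop) fun ζ => ?_
  simpa using coe_sub_ne_zero hz ζ

lemma continuousOn_diskKernel (ζ : Circle) :
    ContinuousOn (fun z => diskKernel z ζ) (ball (0 : ℂ) 1) := by
  unfold diskKernel
  refine ContinuousOn.div (by fun_prop) (by fun_prop) fun z hz => ?_
  simpa using coe_sub_ne_zero hz ζ

/-- Unimodularity of `ζ` and `η` makes the two distances equal. This symmetry lets Fubini move the
Poisson kernel from one function to the other in `integral_pow_mul_eq_zero`. -/
lemma diskKernel_symm (r : ℝ) (ζ η : Circle) :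
    diskKernel (r * ζ) η = diskKernel (r * η) ζ := by
  have h : ‖(η : ℂ) - r * ζ‖ ^ 2 = ‖(ζ : ℂ) - r * η‖ ^ 2 := by
    have h1 := Circle.normSq_coe ζ
    have h2 := Circle.normSq_coe η
    rw [← Complex.normSq_eq_norm_sq, ← Complex.normSq_eq_norm_sq]
    simp only [Complex.normSq_apply, Complex.sub_re, Complex.sub_im, Complex.mul_re,
      Complex.mul_im, Complex.ofReal_re, Complex.ofReal_im] at *
    linear_combination (r ^ 2 - 1) * (h1 - h2)
  simp only [diskKernel, h, norm_mul, Circle.norm_coe]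

lemma measurableEmbedding_toCircle :
    MeasurableEmbedding (AddCircle.toCircle : UnitAddCircle → Circle) :=
  (AddCircle.continuous_toCircle).isClosedEmbedding
    (AddCircle.injective_toCircle one_ne_zero) |>.measurableEmbedding

lemma integral_arcMeasure (F : ℂ → ℂ) :
    ∫ ζ : Circle, F ζ ∂arcMeasure = Real.circleAverage F 0 1 := by
  rw [arcMeasure, measurableEmbedding_toCircle.integral_map, AddCircle.integral_haarAddCircle,
    ← UnitAddCircle.intervalIntegral_preimage 0, Real.circleAverage_def]
  have h := intervalIntegral.integral_comp_mul_left
    (fun θ : ℝ => F (circleMap 0 1 θ)) (c := 2 * Real.pi) (a := 0) (b := 1) (by positivity)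
  simp only [mul_zero, mul_one] at h
  rw [← h]
  simp [AddCircle.toCircle_apply_mk, circleMap]

lemma poissonIntegral_diffContOnCl {F : ℂ → ℂ} (hF : DiffContOnCl ℂ F (ball (0 : ℂ) 1)) {z : ℂ}
    (hz : z ∈ ball (0 : ℂ) 1) : poissonIntegral (fun ζ : Circle => F ζ) z = F z := by
  have h := hF.circleAverage_poissonKernel_smul' hz
  rw [← h, ← Real.circleAverage_congr_sphere (f₁ := fun w => ((1 - ‖z‖ ^ 2) / ‖w - z‖ ^ 2) • F w),
    ← integral_arcMeasure]
  · rfl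
  · intro w hw
    have : ‖w‖ = 1 := by simpa using hw
    simp [this]

lemma integral_diskKernel {z : ℂ} (hz : z ∈ ball (0 : ℂ) 1) :
    ∫ ζ, diskKernel z ζ ∂arcMeasure = 1 := by
  have h := poissonIntegral_diffContOnCl (F := fun _ => 1) diffContOnCl_const hz
  simp only [poissonIntegral_eq, Complex.real_smul, mul_one] at h
  rw [integral_complex_ofReal] at h
  exact_mod_cast h

section Integral

variable {E : Type*} [NormedAddCommGroup E] [NormedSpace ℝ E]

lemma poissonIntegral_congr_ae {f g : Circle → E} (h : f =ᵐ[arcMeasure] g) :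
    poissonIntegral f = poissonIntegral g := by
  funext z
  refine integral_congr_ae ?_
  filter_upwards [h] with ζ hζ
  simp [hζ]

lemma integrable_diskKernel_smul {f : Circle → E} (hf : Integrable f arcMeasure) {z : ℂ}
    (hz : z ∈ ball (0 : ℂ) 1) : Integrable (fun ζ => diskKernel z ζ • f ζ) arcMeasure := by
  refine hf.bdd_smul (1 / (1 - ‖z‖) ^ 2)
    (continuous_diskKernel hz).aestronglyMeasurable (ae_of_all _ fun ζ => ?_)
  exact norm_diskKernel_le (mem_ball_zero_iff.1 hz) le_rfl ζ

lemma poissonIntegral_sub {f g : Circle → E} (hf : Integrable f arcMeasure)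
    (hg : Integrable g arcMeasure) {z : ℂ} (hz : z ∈ ball (0 : ℂ) 1) :
    poissonIntegral (fun ζ => f ζ - g ζ) z = poissonIntegral f z - poissonIntegral g z := by
  simp only [poissonIntegral_eq, smul_sub]
  exact integral_sub (integrable_diskKernel_smul hf hz) (integrable_diskKernel_smul hg hz)

lemma continuousOn_poissonIntegral {f : Circle → E} (hf : Integrable f arcMeasure) {ρ : ℝ}
    (hρ : ρ < 1) : ContinuousOn (poissonIntegral f) (closedBall (0 : ℂ) ρ) := by
  have hsub : closedBall (0 : ℂ) ρ ⊆ ball 0 1 := closedBall_subset_ball hρ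
  refine continuousOn_of_dominated (bound := fun ζ => 1 / (1 - ρ) ^ 2 * ‖f ζ‖)
    (fun z hz => (integrable_diskKernel_smul hf (hsub hz)).aestronglyMeasurable) ?_
    (hf.norm.const_mul _) (ae_of_all _ fun ζ => ?_)
  · intro z hz
    refine ae_of_all _ fun ζ => ?_
    rw [norm_smul]
    gcongr
    exact norm_diskKernel_le hρ (mem_closedBall_zero_iff.1 hz) ζ
  · exact ((continuousOn_diskKernel ζ).mono hsub).smul continuousOn_const

end Integral

lemma poissonIntegral_const (c : ℝ) {z : ℂ} (hz : z ∈ ball (0 : ℂ) 1) :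
    poissonIntegral (fun _ => c) z = c := by
  simp only [poissonIntegral_eq, smul_eq_mul]
  rw [integral_mul_const, integral_diskKernel hz, one_mul]

lemma poissonIntegral_const_mul (c : ℂ) (f : Circle → ℂ) (z : ℂ) :
    poissonIntegral (fun ζ => c * f ζ) z = c * poissonIntegral f z := by
  simp only [poissonIntegral_eq, Complex.real_smul]
  rw [← integral_const_mul]
  congr 1 with ζ
  ring

lemma poissonIntegral_conj (f : Circle → ℂ) (z : ℂ) :
    poissonIntegral (fun ζ => starRingEnd ℂ (f ζ)) z = starRingEnd ℂ (poissonIntegral f z) := by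
  simp only [poissonIntegral_eq, Complex.real_smul]
  rw [← integral_conj]
  simp

lemma poissonIntegral_nonneg {g : Circle → ℝ} (hg : 0 ≤ᵐ[arcMeasure] g) {z : ℂ}
    (hz : z ∈ ball (0 : ℂ) 1) : 0 ≤ poissonIntegral g z := by
  refine integral_nonneg_of_ae ?_
  filter_upwards [hg] with ζ hζ
  exact mul_nonneg (diskKernel_pos hz ζ).le hζ

lemma ae_eq_zero_of_poissonIntegral_eq_zero {g : Circle → ℝ} (hg : 0 ≤ᵐ[arcMeasure] g)
    (hgi : Integrable g arcMeasure) {z : ℂ} (hz : z ∈ ball (0 : ℂ) 1)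
    (h : poissonIntegral g z = 0) : g =ᵐ[arcMeasure] 0 := by
  have hnn : 0 ≤ᵐ[arcMeasure] fun ζ => diskKernel z ζ • g ζ := by
    filter_upwards [hg] with ζ hζ
    exact mul_nonneg (diskKernel_pos hz ζ).le hζ
  rw [poissonIntegral_eq, integral_eq_zero_iff_of_nonneg_ae hnn
    (integrable_diskKernel_smul hgi hz)] at h
  filter_upwards [h] with ζ hζ
  exact (mul_eq_zero.1 hζ).resolve_left (diskKernel_pos hz ζ).ne'

/-! ### Oscillation and the norm-attaining extremal functions. -/

lemma oscillation_congr_ae {f g : Circle → ℂ} (h : f =ᵐ[arcMeasure] g) :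
    oscillation f = oscillation g := by
  funext z
  rw [oscillation, oscillation, poissonIntegral_congr_ae h, poissonIntegral_congr_ae
    (f := fun ζ => ‖f ζ‖ ^ 2) (g := fun ζ => ‖g ζ‖ ^ 2)]
  filter_upwards [h] with ζ hζ
  rw [hζ]

lemma oscillation_const_mul_of_norm_eq_one (c : ℂ) {I : Circle → ℂ}
    (hI : ∀ᵐ ζ ∂arcMeasure, ‖I ζ‖ = 1) {z : ℂ} (hz : z ∈ ball (0 : ℂ) 1) :
    oscillation (fun ζ => c * I ζ) z = ‖c‖ ^ 2 * (1 - ‖poissonIntegral I z‖ ^ 2) := by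
  have h : (fun ζ => ‖c * I ζ‖ ^ 2) =ᵐ[arcMeasure] fun _ => ‖c‖ ^ 2 := by
    filter_upwards [hI] with ζ hζ
    simp [hζ]
  rw [oscillation, poissonIntegral_congr_ae h, poissonIntegral_const _ hz,
    poissonIntegral_const_mul, norm_mul]
  ring

lemma ae_norm_le_of_memLp_top {f : Circle → ℂ} (hf : MemLp f ∞ arcMeasure) :
    ∀ᵐ ζ ∂arcMeasure, ‖f ζ‖ ≤ (eLpNorm f ∞ arcMeasure).toReal := by
  have h : ∀ᵐ ζ ∂arcMeasure, ‖f ζ‖ₑ ≤ eLpNorm f ∞ arcMeasure := by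
    rw [eLpNorm_exponent_top]
    exact ae_le_eLpNormEssSup
  filter_upwards [h] with ζ hζ
  rw [← toReal_enorm]
  exact ENNReal.toReal_mono hf.2.ne hζ

lemma integrable_norm_sq_of_memLp_top {f : Circle → ℂ} (hf : MemLp f ∞ arcMeasure) :
    Integrable (fun ζ => ‖f ζ‖ ^ 2) arcMeasure :=
  (memLp_two_iff_integrable_sq_norm hf.1).1 (hf.mono_exponent le_top)

lemma garsiaNorm_eq_of_isMax {f : Circle → ℂ} {z₀ : ℂ} (hz₀ : z₀ ∈ ball (0 : ℂ) 1)
    (h : ∀ z ∈ ball (0 : ℂ) 1, oscillation f z ≤ oscillation f z₀) :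
    garsiaNorm f = ENNReal.ofReal √(oscillation f z₀) := by
  refine le_antisymm (iSup₂_le fun z hz => ?_) (le_iSup₂_of_le z₀ hz₀ le_rfl)
  exact ENNReal.ofReal_le_ofReal (Real.sqrt_le_sqrt (h z hz))

lemma isInner_of_ae {f : Circle → ℂ} (hf : f ∈ Hardy ∞) {c : ℂ} (hc : c ≠ 0)
    (h : ∀ᵐ ζ ∂arcMeasure, ‖f ζ‖ = ‖c‖) : IsInner fun ζ => c⁻¹ * f ζ := by
  refine ⟨⟨hf.1.const_mul _, ?_⟩, ?_⟩
  · have : poissonIntegral (fun ζ => c⁻¹ * f ζ) = fun z => c⁻¹ * poissonIntegral f z :=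
      funext (poissonIntegral_const_mul _ _)
    rw [this]
    exact analyticOnNhd_const.mul hf.2
  · filter_upwards [h] with ζ hζ
    rw [norm_mul, hζ, norm_inv, inv_mul_cancel₀ (norm_ne_zero_iff.2 hc)]

lemma isInner_coe : IsInner fun ζ : Circle => (ζ : ℂ) := by
  refine ⟨⟨?_, ?_⟩, ae_of_all _ fun ζ => Circle.norm_coe ζ⟩
  · exact memLp_top_of_bound (by fun_prop : Continuous fun ζ : Circle => (ζ : ℂ)).aestronglyMeasurable
      1 (ae_of_all _ fun ζ => (Circle.norm_coe ζ).le)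
  · refine AnalyticOnNhd.congr isOpen_ball analyticOnNhd_id fun z hz => ?_
    exact (poissonIntegral_diffContOnCl (F := fun z => z) differentiable_id.diffContOnCl hz).symm

lemma exists_inner_of_normAttaining {f : Circle → ℂ} (hf : f ∈ BMOna ∩ Hardy ∞)
    (hG : IsGExtremal f) :
    ∃ (c : ℂ) (I : Circle → ℂ), IsInner I ∧ (∃ z ∈ ball (0 : ℂ) 1, poissonIntegral I z = 0) ∧
      f =ᵐ[arcMeasure] fun ζ => c * I ζ := by
  obtain ⟨⟨-, z₀, hz₀, hmax⟩, hH⟩ := hf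
  have hle := ae_norm_le_of_memLp_top hH.1
  have hG2 := hG.2
  set M := (eLpNorm f ∞ arcMeasure).toReal with hM
  rw [garsiaNorm_eq_of_isMax hz₀ hmax] at hG2
  have hsqrt : √(oscillation f z₀) = M := by
    rw [hM, ← hG2, ENNReal.toReal_ofReal (Real.sqrt_nonneg _)]
  have hM0 : 0 ≤ M := ENNReal.toReal_nonneg
  -- If `M = 0`, then `f = 0` a.e., and any inner function with a zero serves; the coordinate
  -- function is taken.
  rcases hM0.eq_or_lt with h0 | hpos
  · refine ⟨0, _, isInner_coe, ⟨0, by simp, ?_⟩, ?_⟩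
    · exact poissonIntegral_diffContOnCl (F := fun z => z) differentiable_id.diffContOnCl (by simp)
    · filter_upwards [hle] with ζ hζ
      rw [← h0] at hζ
      simpa using hζ
  have hosc : oscillation f z₀ = M ^ 2 := by
    rw [← hsqrt, Real.sq_sqrt]
    -- The real square root is `0` on negative arguments, so `M > 0` is what excludes a negative
    -- oscillation.
    by_contra hneg
    rw [Real.sqrt_eq_zero_of_nonpos (not_le.1 hneg).le] at hsqrt
    exact hpos.ne hsqrt
  have hnn : 0 ≤ᵐ[arcMeasure] fun ζ => M ^ 2 - ‖f ζ‖ ^ 2 := by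
    filter_upwards [hle] with ζ hζ
    exact sub_nonneg.2 (pow_le_pow_left₀ (norm_nonneg _) hζ 2)
  have hint := integrable_norm_sq_of_memLp_top hH.1
  have hsub : poissonIntegral (fun ζ => M ^ 2 - ‖f ζ‖ ^ 2) z₀ =
      M ^ 2 - poissonIntegral (fun ζ => ‖f ζ‖ ^ 2) z₀ := by
    rw [poissonIntegral_sub (integrable_const _) hint hz₀, poissonIntegral_const _ hz₀]
  have hge := poissonIntegral_nonneg hnn hz₀
  unfold oscillation at hosc
  -- Both terms of `(M² - P(|f|²)(z₀)) + |Pf(z₀)|² = 0` are nonnegative, so both vanish.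
  have hP : poissonIntegral f z₀ = 0 := by
    rw [← norm_eq_zero, ← sq_eq_zero_iff]
    nlinarith [sq_nonneg ‖poissonIntegral f z₀‖]
  have hz := ae_eq_zero_of_poissonIntegral_eq_zero hnn ((integrable_const _).sub hint) hz₀
    (by rw [hsub, ← hosc, hP]; simp)
  have hMc : (M : ℂ) ≠ 0 := by exact_mod_cast hpos.ne'
  refine ⟨M, _, isInner_of_ae hH hMc ?_, ⟨z₀, hz₀, ?_⟩, ?_⟩
  · filter_upwards [hz] with ζ hζ
    rw [Complex.norm_of_nonneg hM0]
    exact ((sq_eq_sq₀ hM0 (norm_nonneg _)).1 (sub_eq_zero.1 hζ)).symm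
  · rw [poissonIntegral_const_mul, hP, mul_zero]
  · exact ae_of_all _ fun ζ => by field_simp

lemma normAttaining_of_inner {f : Circle → ℂ} {c : ℂ} {I : Circle → ℂ} (hI : IsInner I)
    (hzero : ∃ z ∈ ball (0 : ℂ) 1, poissonIntegral I z = 0)
    (hf : f =ᵐ[arcMeasure] fun ζ => c * I ζ) : f ∈ BMOna ∩ Hardy ∞ ∧ IsGExtremal f := by
  obtain ⟨z₀, hz₀, hIz⟩ := hzero
  have hosc : ∀ z ∈ ball (0 : ℂ) 1,
      oscillation f z = ‖c‖ ^ 2 * (1 - ‖poissonIntegral I z‖ ^ 2) := fun z hz => by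
    rw [oscillation_congr_ae hf, oscillation_const_mul_of_norm_eq_one c hI.2 hz]
  have hosc₀ : oscillation f z₀ = ‖c‖ ^ 2 := by simp [hosc z₀ hz₀, hIz]
  have hmax : ∀ z ∈ ball (0 : ℂ) 1, oscillation f z ≤ oscillation f z₀ := fun z hz => by
    rw [hosc z hz, hosc₀]
    nlinarith [mul_nonneg (sq_nonneg ‖c‖) (sq_nonneg ‖poissonIntegral I z‖)]
  have hmem : MemLp f ∞ arcMeasure := (hI.1.1.const_mul c).ae_eq hf.symm
  refine ⟨⟨⟨⟨hmem.mono_exponent le_top, oscillation f z₀, ?_⟩, z₀, hz₀, hmax⟩, hmem, ?_⟩, hmem, ?_⟩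
  · rintro _ ⟨z, hz, rfl⟩
    exact hmax z hz
  · have : poissonIntegral f = fun z => c * poissonIntegral I z := by
      rw [poissonIntegral_congr_ae hf]
      exact funext (poissonIntegral_const_mul _ _)
    rw [this]
    exact analyticOnNhd_const.mul hI.1.2
  · rw [garsiaNorm_eq_of_isMax hz₀ hmax, hosc₀, Real.sqrt_sq (norm_nonneg c), ofReal_norm]
    have hn : ∀ᵐ ζ ∂arcMeasure, ‖f ζ‖ = ‖c‖ := by
      filter_upwards [hf, hI.2] with ζ h1 h2
      rw [h1, norm_mul, h2, mul_one]
    rw [eLpNorm_congr_norm_ae (g := fun _ => c) hn, eLpNorm_const c (by simp)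
      (NeZero.ne arcMeasure)]
    simp

/-! ### Uniqueness for Poisson integrals, via Fourier coefficients. -/

/-- The Poisson integral of `η ^ n` at `r ζ` is `r ^ n ζ ^ n`. Inserting this, swapping the
integrals and using the symmetry of the kernel leaves the Poisson integral of `h` on the circle of
radius `r`. Any `r` strictly between `0` and `1` would do, so no limit `r → 1` is needed. -/
lemma integral_pow_mul_eq_zero {h : Circle → ℂ} (hh : Integrable h arcMeasure)
    (hP : ∀ z ∈ ball (0 : ℂ) 1, poissonIntegral h z = 0) (n : ℕ) :
    ∫ ζ : Circle, (ζ : ℂ) ^ n * h ζ ∂arcMeasure = 0 := by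
  set r : ℝ := 1 / 2 with hr
  have hball : ∀ ζ : Circle, (r : ℂ) * ζ ∈ ball (0 : ℂ) 1 := fun ζ => by
    rw [mem_ball_zero_iff, norm_mul, Circle.norm_coe, Complex.norm_real]
    norm_num [hr]
  have hcont : Continuous fun p : Circle × Circle => diskKernel (r * p.1) p.2 := by
    unfold diskKernel
    refine Continuous.div (by fun_prop) (by fun_prop) fun p => ?_
    simpa using coe_sub_ne_zero (hball p.1) p.2
  have hint : Integrable (fun p : Circle × Circle =>
      (diskKernel (r * p.1) p.2 * (p.2 : ℂ) ^ n) * h p.1) (arcMeasure.prod arcMeasure) := by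
    refine (hh.comp_fst arcMeasure).bdd_mul (c := 1 / (1 - r) ^ 2) ?_ (ae_of_all _ fun p => ?_)
    · refine Continuous.aestronglyMeasurable ?_
      exact (Complex.continuous_ofReal.comp hcont).mul (by fun_prop)
    · rw [norm_mul, norm_pow, Circle.norm_coe, one_pow, mul_one, Complex.norm_real]
      refine norm_diskKernel_le (by norm_num [hr]) ?_ _
      rw [norm_mul, Circle.norm_coe, Complex.norm_real]
      norm_num [hr]
  have h1 : ∀ ζ : Circle, (r : ℂ) ^ n * ((ζ : ℂ) ^ n * h ζ) =
      ∫ η : Circle, (diskKernel (r * ζ) η * (η : ℂ) ^ n) * h ζ ∂arcMeasure := fun ζ => by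
    have := poissonIntegral_diffContOnCl (F := fun z => z ^ n)
      (differentiable_id.pow n).diffContOnCl (hball ζ)
    rw [integral_mul_const]
    simp only [poissonIntegral_eq, Complex.real_smul] at this
    rw [this, mul_pow, mul_assoc]
  have h2 : (r : ℂ) ^ n * ∫ ζ : Circle, (ζ : ℂ) ^ n * h ζ ∂arcMeasure = 0 := by
    rw [← integral_const_mul]
    simp_rw [h1]
    rw [integral_integral_swap hint]
    have h3 : ∀ η : Circle,
        ∫ ζ : Circle, (diskKernel (r * ζ) η * (η : ℂ) ^ n) * h ζ ∂arcMeasure = 0 := fun η => by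
      have h4 := hP _ (hball η)
      simp only [poissonIntegral_eq, Complex.real_smul] at h4
      rw [← mul_zero ((η : ℂ) ^ n), ← h4, ← integral_const_mul]
      congr 1 with ζ
      rw [diskKernel_symm]
      ring
    simp [h3]
  exact (mul_eq_zero.1 h2).resolve_left (by norm_num [hr])

lemma integral_zpow_mul_eq_zero {h : Circle → ℂ} (hh : Integrable h arcMeasure)
    (hP : ∀ z ∈ ball (0 : ℂ) 1, poissonIntegral h z = 0) (n : ℤ) :
    ∫ ζ : Circle, ((ζ ^ n : Circle) : ℂ) * h ζ ∂arcMeasure = 0 := by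
  rcases Int.eq_nat_or_neg n with ⟨m, rfl | rfl⟩
  · simpa using integral_pow_mul_eq_zero hh hP m
  -- Negative frequencies of `h` are conjugates of positive frequencies of its conjugate, whose
  -- Poisson integral also vanishes.
  · have h1 : Integrable (fun ζ => starRingEnd ℂ (h ζ)) arcMeasure :=
      Complex.conjCLE.toContinuousLinearMap.integrable_comp hh
    have h2 := integral_pow_mul_eq_zero h1
      (fun z hz => by rw [poissonIntegral_conj, hP z hz, map_zero]) m
    rw [← map_eq_zero (starRingEnd ℂ), ← integral_conj] at h2
    rw [← h2]
    congr 1 with ζ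
    rw [zpow_neg, zpow_natCast, Circle.coe_inv_eq_conj]
    simp

/-- A square integrable function on the circle is determined by its Poisson integral. -/
lemma ae_eq_zero_of_poissonIntegral {h : Circle → ℂ} (hh : MemLp h 2 arcMeasure)
    (hP : ∀ z ∈ ball (0 : ℂ) 1, poissonIntegral h z = 0) : h =ᵐ[arcMeasure] 0 := by
  have hmem : MemLp (h ∘ AddCircle.toCircle) 2 (AddCircle.haarAddCircle : Measure UnitAddCircle) :=
    (measurableEmbedding_toCircle.memLp_map_measure_iff).1 hh
  have hcoeff : ∀ n, fourierCoeff (hmem.toLp _ : UnitAddCircle → ℂ) n = 0 := fun n => by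
    have h1 := integral_zpow_mul_eq_zero (hh.integrable one_le_two) hP (-n)
    rw [arcMeasure, measurableEmbedding_toCircle.integral_map] at h1
    rw [fourierCoeff_congr_ae hmem.coeFn_toLp, fourierCoeff, ← h1]
    simp only [fourier_apply, AddCircle.toCircle_zsmul, smul_eq_mul, Function.comp_apply]
  have hzero : hmem.toLp _ = 0 := by
    refine (fourierBasis (T := (1 : ℝ))).repr.injective ?_
    rw [map_zero]
    ext n
    rw [fourierBasis_repr, hcoeff]
    rfl
  have h2 : h ∘ AddCircle.toCircle =ᵐ[(AddCircle.haarAddCircle : Measure UnitAddCircle)] 0 := by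
    rw [← hmem.toLp_eq_toLp_iff (MemLp.zero), hzero]
    rfl
  rw [arcMeasure, EventuallyEq, measurableEmbedding_toCircle.ae_map_iff]
  exact h2

lemma ae_eq_of_poissonIntegral_eq {f g : Circle → ℂ} (hf : MemLp f 2 arcMeasure)
    (hg : MemLp g 2 arcMeasure)
    (h : ∀ z ∈ ball (0 : ℂ) 1, poissonIntegral f z = poissonIntegral g z) :
    f =ᵐ[arcMeasure] g := by
  have := ae_eq_zero_of_poissonIntegral (hf.sub hg) fun z hz => by
    have := poissonIntegral_sub (hf.integrable one_le_two) (hg.integrable one_le_two) hz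
    rw [h z hz, sub_self] at this
    exact this
  filter_upwards [this] with ζ hζ
  exact sub_eq_zero.1 hζ

/-! ### Approach to the boundary and the maximum principle. -/

lemma eventually_boundary_iff {p : ℂ → Prop} :
    (∀ᶠ z in comap norm (𝓝[<] (1 : ℝ)), p z) ↔
      ∃ ρ : ℝ, 0 ≤ ρ ∧ ρ < 1 ∧ ∀ z : ℂ, ρ < ‖z‖ → ‖z‖ < 1 → p z := by
  constructor
  · intro h
    rw [eventually_comap] at h
    obtain ⟨l, hl, hs⟩ := (mem_nhdsLT_iff_exists_Ioo_subset).1 h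
    refine ⟨max l 0, le_max_right _ _, max_lt hl one_pos, fun z h1 h2 => ?_⟩
    exact hs ⟨(le_max_left _ _).trans_lt h1, h2⟩ z rfl
  · rintro ⟨ρ, -, hρ, h⟩
    rw [eventually_comap]
    filter_upwards [Ioo_mem_nhdsLT hρ] with x hx z hz
    exact h z (hz ▸ hx.1) (hz ▸ hx.2)

lemma eventually_boundary_mem_ball :
    ∀ᶠ z in comap norm (𝓝[<] (1 : ℝ)), z ∈ ball (0 : ℂ) 1 :=
  eventually_boundary_iff.2 ⟨0, le_rfl, one_pos, fun _ _ h => mem_ball_zero_iff.2 h⟩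

lemma norm_le_one_of_tendsto_boundary {G : ℂ → ℂ} (hG : DifferentiableOn ℂ G (ball 0 1))
    (ht : Tendsto (fun z => ‖G z‖) (comap norm (𝓝[<] (1 : ℝ))) (𝓝 1)) {z : ℂ}
    (hz : z ∈ ball (0 : ℂ) 1) : ‖G z‖ ≤ 1 := by
  refine le_of_forall_pos_le_add fun ε hε => ?_
  obtain ⟨ρ, hρ0, hρ, h⟩ := eventually_boundary_iff.1
    (ht.eventually (eventually_le_nhds (lt_add_of_pos_right 1 hε)))
  rw [mem_ball_zero_iff] at hz
  -- The circle of radius `R` encloses `z` and lies where `‖G‖ ≤ 1 + ε`, so the maximum principle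
  -- applies on it.
  obtain ⟨R, hR1, hR2⟩ := exists_between (max_lt hρ hz)
  have hR0 : 0 < R := hρ0.trans_lt ((le_max_left _ _).trans_lt hR1)
  refine Complex.norm_le_of_forall_mem_frontier_norm_le (U := ball 0 R) isBounded_ball
    (DifferentiableOn.diffContOnCl ?_) (fun w hw => ?_) (subset_closure ?_)
  · rw [closure_ball _ hR0.ne']
    exact hG.mono (closedBall_subset_ball hR2)
  · rw [frontier_ball _ hR0.ne', mem_sphere_zero_iff_norm] at hw
    exact h w (hw ▸ (le_max_left _ _).trans_lt hR1) (hw ▸ hR2)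
  · exact mem_ball_zero_iff.2 ((le_max_right _ _).trans_lt hR1)

/-! ### Blaschke factors and their finite products. -/

section Factor

lemma le_norm_one_sub_conj_mul (a : ℂ) {z : ℂ} (hz : ‖z‖ ≤ 1) :
    1 - ‖a‖ ≤ ‖1 - starRingEnd ℂ a * z‖ := by
  have h := norm_sub_norm_le (1 : ℂ) (starRingEnd ℂ a * z)
  rw [norm_one, norm_mul, RCLike.norm_conj] at h
  nlinarith [norm_nonneg a, norm_nonneg z]

variable {a : ℂ}

lemma one_sub_conj_mul_ne_zero (ha : a ∈ ball (0 : ℂ) 1) {z : ℂ} (hz : ‖z‖ ≤ 1) :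
    1 - starRingEnd ℂ a * z ≠ 0 := by
  have h := le_norm_one_sub_conj_mul a hz
  rw [mem_ball_zero_iff] at ha
  rw [← norm_pos_iff]
  linarith

/-- This one identity yields unimodularity on the circle, the boundary limit of the modulus, and the
uniform bound below `1` used to limit the number of zeros. -/
lemma norm_sq_blaschkeFactor (ha : a ∈ ball (0 : ℂ) 1) {z : ℂ} (hz : ‖z‖ ≤ 1) :
    ‖blaschkeFactor a z‖ ^ 2 =
      1 - (1 - ‖a‖ ^ 2) * (1 - ‖z‖ ^ 2) / ‖1 - starRingEnd ℂ a * z‖ ^ 2 := by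
  have hne := norm_ne_zero_iff.2 (one_sub_conj_mul_ne_zero ha hz)
  have hu : ‖(if a = 0 then -1 else (‖a‖ : ℂ) / a)‖ = 1 := by
    split_ifs with h
    · simp
    · simp [h]
  have key : ‖a - z‖ ^ 2 =
      ‖1 - starRingEnd ℂ a * z‖ ^ 2 - (1 - ‖a‖ ^ 2) * (1 - ‖z‖ ^ 2) := by
    simp only [← Complex.normSq_eq_norm_sq, Complex.normSq_apply, Complex.sub_re, Complex.sub_im,
      Complex.mul_re, Complex.mul_im, Complex.conj_re, Complex.conj_im, Complex.one_re,
      Complex.one_im]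
    ring
  rw [blaschkeFactor, norm_mul, hu, one_mul, norm_div, div_pow, key]
  field_simp

lemma norm_blaschkeFactor_circle (ha : a ∈ ball (0 : ℂ) 1) (ζ : Circle) :
    ‖blaschkeFactor a ζ‖ = 1 := by
  have h := norm_sq_blaschkeFactor ha (Circle.norm_coe ζ).le
  rw [Circle.norm_coe] at h
  rw [← sq_eq_sq₀ (norm_nonneg _) zero_le_one, h]
  simp

lemma differentiableOn_blaschkeFactor (ha : a ∈ ball (0 : ℂ) 1) :
    DifferentiableOn ℂ (blaschkeFactor a) (closedBall 0 1) := by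
  unfold blaschkeFactor
  refine DifferentiableOn.const_mul (DifferentiableOn.div (by fun_prop) (by fun_prop) ?_) _
  exact fun z hz => one_sub_conj_mul_ne_zero ha (mem_closedBall_zero_iff.1 hz)

lemma tendsto_norm_blaschkeFactor (ha : a ∈ ball (0 : ℂ) 1) :
    Tendsto (fun z => ‖blaschkeFactor a z‖) (comap norm (𝓝[<] (1 : ℝ))) (𝓝 1) := by
  have hn : Tendsto (fun z : ℂ => ‖z‖) (comap norm (𝓝[<] (1 : ℝ))) (𝓝 1) :=
    tendsto_comap.mono_right nhdsWithin_le_nhds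
  have h0 : Tendsto (fun z : ℂ => (1 - ‖a‖ ^ 2) * (1 - ‖z‖ ^ 2) / (1 - ‖a‖) ^ 2)
      (comap norm (𝓝[<] (1 : ℝ))) (𝓝 0) := by
    have := (((hn.pow 2).const_sub 1).const_mul (1 - ‖a‖ ^ 2)).div_const ((1 - ‖a‖) ^ 2)
    simpa using this
  have ha' := mem_ball_zero_iff.1 ha
  have ha2 : 0 ≤ 1 - ‖a‖ ^ 2 := by nlinarith [norm_nonneg a]
  have h1 : Tendsto (fun z : ℂ => (1 - ‖a‖ ^ 2) * (1 - ‖z‖ ^ 2) /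
      ‖1 - starRingEnd ℂ a * z‖ ^ 2) (comap norm (𝓝[<] (1 : ℝ))) (𝓝 0) := by
    refine squeeze_zero' ?_ ?_ h0
    all_goals
      filter_upwards [eventually_boundary_mem_ball] with z hz
      rw [mem_ball_zero_iff] at hz
      have hz2 : 0 ≤ 1 - ‖z‖ ^ 2 := by nlinarith [norm_nonneg z]
    · positivity
    · have h2 := le_norm_one_sub_conj_mul a hz.le
      have h3 : 0 < 1 - ‖a‖ := by linarith
      gcongr
  have h2 : Tendsto (fun z => ‖blaschkeFactor a z‖ ^ 2) (comap norm (𝓝[<] (1 : ℝ))) (𝓝 1) := by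
    have h3 := h1.const_sub 1
    rw [sub_zero] at h3
    refine h3.congr' ?_
    filter_upwards [eventually_boundary_mem_ball] with z hz
    exact (norm_sq_blaschkeFactor ha (mem_ball_zero_iff.1 hz).le).symm
  simpa [Real.sqrt_sq] using h2.sqrt

lemma exists_eq_blaschkeFactor_mul (ha : a ∈ ball (0 : ℂ) 1) {F : ℂ → ℂ}
    (hF : DifferentiableOn ℂ F (ball 0 1))
    (hFa : F a = 0) : ∃ G : ℂ → ℂ, DifferentiableOn ℂ G (ball 0 1) ∧
      ∀ z ∈ ball (0 : ℂ) 1, F z = blaschkeFactor a z * G z := by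
  set u : ℂ := if a = 0 then -1 else (‖a‖ : ℂ) / a with hu
  have hu0 : u ≠ 0 := by
    rw [hu]
    split_ifs with h
    · simp
    · simp [h]
  refine ⟨fun z => -u⁻¹ * (1 - starRingEnd ℂ a * z) * dslope F a z, ?_, fun z hz => ?_⟩
  · refine DifferentiableOn.mul (by fun_prop) ?_
    exact (Complex.differentiableOn_dslope (isOpen_ball.mem_nhds ha)).2 hF
  · have h1 := one_sub_conj_mul_ne_zero ha (mem_ball_zero_iff.1 hz).le
    have h2 := sub_smul_dslope F a z
    rw [hFa, sub_zero, smul_eq_mul] at h2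
    rw [blaschkeFactor, ← hu, ← h2]
    beta_reduce
    generalize 1 - starRingEnd ℂ a * z = d at h1
    field_simp
    ring

end Factor

section Product

variable {n : ℕ} {a : Fin n → ℂ}

lemma diffContOnCl_prod_blaschkeFactor (ha : ∀ j, a j ∈ ball (0 : ℂ) 1) :
    DiffContOnCl ℂ (fun z => ∏ j, blaschkeFactor (a j) z) (ball 0 1) := by
  refine DifferentiableOn.diffContOnCl ?_
  rw [closure_ball _ one_ne_zero]
  exact DifferentiableOn.fun_finsetProd fun j _ => differentiableOn_blaschkeFactor (ha j)

lemma tendsto_norm_prod_blaschkeFactor (ha : ∀ j, a j ∈ ball (0 : ℂ) 1) :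
    Tendsto (fun z => ‖∏ j, blaschkeFactor (a j) z‖) (comap norm (𝓝[<] (1 : ℝ))) (𝓝 1) := by
  have h := tendsto_finsetProd Finset.univ fun j _ => tendsto_norm_blaschkeFactor (ha j)
  simpa [norm_prod] using h

lemma norm_prod_blaschkeFactor_circle (ha : ∀ j, a j ∈ ball (0 : ℂ) 1) (ζ : Circle) :
    ‖∏ j, blaschkeFactor (a j) ζ‖ = 1 := by
  rw [norm_prod]
  exact Finset.prod_eq_one fun j _ => norm_blaschkeFactor_circle (ha j) ζ

lemma tendsto_norm_of_eq_prod_mul (ha : ∀ j, a j ∈ ball (0 : ℂ) 1)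
    {F G : ℂ → ℂ}
    (hF : Tendsto (fun z => ‖F z‖) (comap norm (𝓝[<] (1 : ℝ))) (𝓝 1))
    (h : ∀ z ∈ ball (0 : ℂ) 1, F z = (∏ j, blaschkeFactor (a j) z) * G z) :
    Tendsto (fun z => ‖G z‖) (comap norm (𝓝[<] (1 : ℝ))) (𝓝 1) := by
  have hB := tendsto_norm_prod_blaschkeFactor ha
  have hq := hF.div hB one_ne_zero
  rw [div_one] at hq
  refine hq.congr' ?_
  filter_upwards [eventually_boundary_mem_ball, hB.eventually_ne one_ne_zero] with z hz hne
  rw [Pi.div_apply, h z hz, norm_mul, mul_div_cancel_left₀ _ hne]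

end Product

/-! ### Analytic functions with unimodular boundary limit. -/

/-- The maximum principle bounds both `G` and `1 / G` by `1`, so `|G|` is constant. -/
lemma exists_const_of_forall_ne_zero {G : ℂ → ℂ} (hG : DifferentiableOn ℂ G (ball 0 1))
    (ht : Tendsto (fun z => ‖G z‖) (comap norm (𝓝[<] (1 : ℝ))) (𝓝 1))
    (h0 : ∀ z ∈ ball (0 : ℂ) 1, G z ≠ 0) : ∃ c, ∀ z ∈ ball (0 : ℂ) 1, G z = c := by
  have hnorm : ∀ z ∈ ball (0 : ℂ) 1, ‖G z‖ = 1 := fun z hz => by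
    refine le_antisymm (norm_le_one_of_tendsto_boundary hG ht hz) ?_
    have h := norm_le_one_of_tendsto_boundary (G := fun z => (G z)⁻¹) (hG.inv h0)
      (by simpa [norm_inv] using ht.inv₀ one_ne_zero) hz
    rw [norm_inv] at h
    exact (inv_le_one₀ (norm_pos_iff.2 (h0 z hz))).1 h
  refine ⟨G 0, Complex.eqOn_of_isPreconnected_of_isMaxOn_norm
    (convex_ball (0 : ℂ) 1).isPreconnected isOpen_ball hG (mem_ball_self one_pos) ?_⟩
  intro z hz
  simp [hnorm z hz, hnorm 0 (mem_ball_self one_pos)]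

/-- An analytic function on the disk whose modulus tends to `1` at the boundary is a constant
multiple of a finite Blaschke product. -/
theorem exists_finiteBlaschkeProduct {F : ℂ → ℂ} (hF : DifferentiableOn ℂ F (ball 0 1))
    (ht : Tendsto (fun z => ‖F z‖) (comap norm (𝓝[<] (1 : ℝ))) (𝓝 1)) :
    ∃ (c : ℂ) (B : ℂ → ℂ), IsFiniteBlaschkeProduct B ∧ ∀ z ∈ ball (0 : ℂ) 1, F z = c * B z := by
  by_contra hcon
  obtain ⟨ρ, hρ0, hρ, hlarge⟩ := eventually_boundary_iff.1
    (ht.eventually (eventually_gt_nhds (by norm_num : (1 / 2 : ℝ) < 1)))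
  -- If `F` is not of the desired form, zeros can be divided out forever: a zero-free quotient would
  -- be constant. All of them lie in `‖z‖ ≤ ρ`, since `‖F‖ > 1/2` outside.
  have hrem : ∀ n : ℕ, ∃ (a : Fin n → ℂ) (G : ℂ → ℂ), (∀ j, ‖a j‖ ≤ ρ) ∧
      DifferentiableOn ℂ G (ball 0 1) ∧
      ∀ z ∈ ball (0 : ℂ) 1, F z = (∏ j, blaschkeFactor (a j) z) * G z := by
    intro n
    induction n with
    | zero => exact ⟨Fin.elim0, F, fun j => j.elim0, hF, fun z _ => by simp⟩
    | succ n ih =>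
      obtain ⟨a, G, ha, hG, h⟩ := ih
      have ha' : ∀ j, a j ∈ ball (0 : ℂ) 1 := fun j =>
        mem_ball_zero_iff.2 ((ha j).trans_lt hρ)
      have hzero : ∃ b ∈ ball (0 : ℂ) 1, G b = 0 := by
        by_contra! h0
        obtain ⟨c, hc⟩ := exists_const_of_forall_ne_zero hG
          (tendsto_norm_of_eq_prod_mul ha' ht h) h0
        exact hcon ⟨c, _, ⟨n, a, ha', rfl⟩, fun z hz => by rw [h z hz, hc z hz, mul_comm]⟩
      obtain ⟨b, hb, hGb⟩ := hzero
      obtain ⟨H, hH, hGH⟩ := exists_eq_blaschkeFactor_mul hb hG hGb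
      have hbρ : ‖b‖ ≤ ρ := by
        by_contra! hlt
        have := hlarge b hlt (mem_ball_zero_iff.1 hb)
        rw [h b hb, hGb, mul_zero, norm_zero] at this
        linarith
      refine ⟨Fin.cons b a, H, fun j => ?_, hH, fun z hz => ?_⟩
      · exact Fin.cases (motive := fun j => ‖Fin.cons (α := fun _ => ℂ) b a j‖ ≤ ρ) hbρ ha j
      · rw [h z hz, hGH z hz, Fin.prod_univ_succ]
        simp only [Fin.cons_zero, Fin.cons_succ]
        ring
  obtain ⟨w, hw1, hw2⟩ := exists_between hρ
  have hw : ‖(w : ℂ)‖ = w := Complex.norm_of_nonneg (hρ0.trans hw1.le)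
  have hwb : (w : ℂ) ∈ ball (0 : ℂ) 1 := by rwa [mem_ball_zero_iff, hw]
  -- A bound at `w`, uniform over zeros in `‖b‖ ≤ ρ`; the `4` comes from `|1 - conj b * w| ≤ 2`.
  set q : ℝ := 1 - (1 - ρ ^ 2) * (1 - w ^ 2) / 4 with hq
  have hρ2 : 0 < 1 - ρ ^ 2 := by nlinarith
  have hwsq : 0 < 1 - w ^ 2 := by nlinarith
  have hq1 : q < 1 := by
    have := mul_pos hρ2 hwsq
    rw [hq]
    linarith
  have hfac : ∀ b : ℂ, ‖b‖ ≤ ρ → ‖blaschkeFactor b w‖ ^ 2 ≤ q := fun b hb => by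
    have hbb : b ∈ ball (0 : ℂ) 1 := mem_ball_zero_iff.2 (hb.trans_lt hρ)
    have hden : ‖1 - starRingEnd ℂ b * w‖ ≤ 2 := by
      refine (norm_sub_le _ _).trans ?_
      rw [norm_one, norm_mul, RCLike.norm_conj, hw]
      nlinarith [norm_nonneg b]
    have hpos : 0 < ‖1 - starRingEnd ℂ b * w‖ :=
      norm_pos_iff.2 (one_sub_conj_mul_ne_zero hbb (hw.trans_le hw2.le))
    rw [norm_sq_blaschkeFactor hbb (hw.trans_le hw2.le), hq, hw]
    refine sub_le_sub_left ?_ 1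
    have hb2 : ‖b‖ ^ 2 ≤ ρ ^ 2 := pow_le_pow_left₀ (norm_nonneg b) hb 2
    gcongr
    · nlinarith
    · nlinarith
  have hq0 : 0 ≤ q := (sq_nonneg _).trans (hfac 0 (by simpa using hρ0))
  -- With `n` factors removed, `‖F w‖² ≤ q ^ n < 1/4`, against `‖F w‖ > 1/2`.
  obtain ⟨n, hn⟩ := exists_pow_lt_of_lt_one (by norm_num : (0 : ℝ) < 1 / 4) hq1
  obtain ⟨a, G, ha, hG, h⟩ := hrem n
  have hGw := norm_le_one_of_tendsto_boundary hG (tendsto_norm_of_eq_prod_mul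
    (fun j => mem_ball_zero_iff.2 ((ha j).trans_lt hρ)) ht h) hwb
  have hprod : ‖∏ j, blaschkeFactor (a j) w‖ ^ 2 ≤ q ^ n := by
    rw [norm_prod, ← Finset.prod_pow]
    refine (Finset.prod_le_prod (fun j _ => sq_nonneg _) fun j _ => hfac _ (ha j)).trans ?_
    simp
  have hFw := hlarge w (hw.symm ▸ hw1) (hw.symm ▸ hw2)
  have hle : ‖F w‖ ≤ ‖∏ j, blaschkeFactor (a j) w‖ := by
    rw [h w hwb, norm_mul]
    exact mul_le_of_le_one_right (norm_nonneg _) hGw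
  nlinarith [norm_nonneg (F w)]

/-! ### Vanishing oscillation and finite Blaschke products. -/

lemma continuousOn_oscillation {f : Circle → ℂ} (hf : MemLp f 2 arcMeasure) {ρ : ℝ}
    (hρ : ρ < 1) : ContinuousOn (oscillation f) (closedBall (0 : ℂ) ρ) :=
  (continuousOn_poissonIntegral ((memLp_two_iff_integrable_sq_norm hf.1).1 hf) hρ).sub
    ((continuousOn_poissonIntegral (hf.integrable one_le_two) hρ).norm.pow 2)

/-- Near the boundary the oscillation is below its value at `z₁`, so its maximum over a compact disk
is global. -/
lemma mem_BMOna_of_mem_VMO {f : Circle → ℂ} (hf : f ∈ VMO) {z₁ : ℂ}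
    (hz₁ : z₁ ∈ ball (0 : ℂ) 1) (hpos : 0 < oscillation f z₁) : f ∈ BMOna := by
  obtain ⟨ρ, hρ0, hρ, hsmall⟩ := eventually_boundary_iff.1
    (hf.2.eventually (eventually_lt_nhds hpos))
  obtain ⟨z₀, hz₀, hmax⟩ := (isCompact_closedBall (0 : ℂ) ρ).exists_isMaxOn
    ⟨0, mem_closedBall_self hρ0⟩ (continuousOn_oscillation hf.1.1 hρ)
  have hz₁ρ : z₁ ∈ closedBall (0 : ℂ) ρ := by
    rw [mem_closedBall_zero_iff]
    by_contra! h
    exact lt_irrefl _ (hsmall z₁ h (mem_ball_zero_iff.1 hz₁))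
  refine ⟨hf.1, z₀, closedBall_subset_ball hρ hz₀, fun z hz => ?_⟩
  by_cases h : ‖z‖ ≤ ρ
  · exact hmax (mem_closedBall_zero_iff.2 h)
  · exact (hsmall z (not_le.1 h) (mem_ball_zero_iff.1 hz)).le.trans (hmax hz₁ρ)

lemma exists_oscillation_pos {f : Circle → ℂ} (h : garsiaNorm f ≠ 0) :
    ∃ z ∈ ball (0 : ℂ) 1, 0 < oscillation f z := by
  contrapose! h
  refine le_antisymm (iSup₂_le fun z hz => ?_) zero_le
  rw [Real.sqrt_eq_zero_of_nonpos (h z hz), ENNReal.ofReal_zero]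

lemma isInner_finiteBlaschkeProduct {n : ℕ} {a : Fin n → ℂ} (ha : ∀ j, a j ∈ ball (0 : ℂ) 1) :
    IsInner fun ζ : Circle => ∏ j, blaschkeFactor (a j) ζ := by
  have hd := diffContOnCl_prod_blaschkeFactor ha
  have hn := norm_prod_blaschkeFactor_circle ha
  refine ⟨⟨memLp_top_of_bound (Continuous.aestronglyMeasurable ?_) 1
    (ae_of_all _ fun ζ => (hn ζ).le), ?_⟩, ae_of_all _ hn⟩
  · refine hd.continuousOn.comp_continuous (by fun_prop) fun ζ => ?_
    rw [closure_ball _ one_ne_zero, mem_closedBall_zero_iff, Circle.norm_coe]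
  · exact (hd.differentiableOn.analyticOnNhd isOpen_ball).congr isOpen_ball
      fun z hz => (poissonIntegral_diffContOnCl hd hz).symm

lemma isFiniteBlaschkeProduct_id : IsFiniteBlaschkeProduct fun z => z :=
  ⟨1, fun _ => 0, fun _ => mem_ball_self one_pos, by simp [blaschkeFactor]⟩

lemma not_exists_const_of_tendsto_norm {F : ℂ → ℂ}
    (ht : Tendsto (fun z => ‖F z‖) (comap norm (𝓝[<] (1 : ℝ))) (𝓝 1)) {z₀ : ℂ}
    (hz₀ : z₀ ∈ ball (0 : ℂ) 1) (h0 : F z₀ = 0) :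
    ¬ ∃ k : ℂ, ∀ z ∈ ball (0 : ℂ) 1, F z = k := by
  rintro ⟨k, hk⟩
  obtain ⟨ρ, hρ0, hρ, hne⟩ := eventually_boundary_iff.1 (ht.eventually_ne one_ne_zero)
  obtain ⟨w, hw1, hw2⟩ := exists_between hρ
  have hw : ‖(w : ℂ)‖ = w := Complex.norm_of_nonneg (hρ0.trans hw1.le)
  refine hne w (hw.symm ▸ hw1) (hw.symm ▸ hw2) ?_
  rw [hk w (by rwa [mem_ball_zero_iff, hw]), ← hk z₀ hz₀, h0, norm_zero]

lemma exists_finiteBlaschkeProduct_of_inner {I : Circle → ℂ} (hI : IsInner I)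
    (hzero : ∃ z ∈ ball (0 : ℂ) 1, poissonIntegral I z = 0)
    (ht : Tendsto (fun z => ‖poissonIntegral I z‖) (comap norm (𝓝[<] (1 : ℝ))) (𝓝 1)) :
    ∃ (c : ℂ) (B : ℂ → ℂ), IsFiniteBlaschkeProduct B ∧
      (¬ ∃ k : ℂ, ∀ z ∈ ball (0 : ℂ) 1, B z = k) ∧ I =ᵐ[arcMeasure] fun ζ => c * B ζ := by
  obtain ⟨c, B, hB, hIB⟩ := exists_finiteBlaschkeProduct hI.1.2.differentiableOn ht
  refine ⟨c, B, hB, ?_, ?_⟩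
  · rintro ⟨k, hk⟩
    obtain ⟨z₀, hz₀, h0⟩ := hzero
    exact not_exists_const_of_tendsto_norm ht hz₀ h0
      ⟨c * k, fun z hz => by rw [hIB z hz, hk z hz]⟩
  · obtain ⟨n, a, ha, rfl⟩ := hB
    refine ae_eq_of_poissonIntegral_eq (hI.1.1.mono_exponent le_top)
      (((isInner_finiteBlaschkeProduct ha).1.1.const_mul c).mono_exponent le_top) fun z hz => ?_
    rw [hIB z hz, poissonIntegral_const_mul,
      poissonIntegral_diffContOnCl (diffContOnCl_prod_blaschkeFactor ha) hz]

/-- Solve `Φ_f = |c|²(1 - |PI|²)` for `|PI|²`, which requires `c ≠ 0`. -/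
lemma tendsto_norm_poissonIntegral_of_mem_VMO {f I : Circle → ℂ} {c : ℂ} (hc : c ≠ 0)
    (hI : ∀ᵐ ζ ∂arcMeasure, ‖I ζ‖ = 1) (hf : f =ᵐ[arcMeasure] fun ζ => c * I ζ) (hV : f ∈ VMO) :
    Tendsto (fun z => ‖poissonIntegral I z‖) (comap norm (𝓝[<] (1 : ℝ))) (𝓝 1) := by
  have h1 := (hV.2.div_const (‖c‖ ^ 2)).const_sub 1
  rw [zero_div, sub_zero] at h1
  have h2 : Tendsto (fun z => ‖poissonIntegral I z‖ ^ 2) (comap norm (𝓝[<] (1 : ℝ))) (𝓝 1) := by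
    refine h1.congr' ?_
    filter_upwards [eventually_boundary_mem_ball] with z hz
    rw [oscillation_congr_ae hf, oscillation_const_mul_of_norm_eq_one c hI hz]
    have := norm_ne_zero_iff.2 hc
    field_simp
    ring
  simpa [Real.sqrt_sq] using h2.sqrt

lemma exists_finiteBlaschkeProduct_of_mem_QA {f : Circle → ℂ} (hf : f ∈ QA)
    (hG : IsGExtremal f) :
    ∃ (c : ℂ) (B : ℂ → ℂ), IsFiniteBlaschkeProduct B ∧
      (¬ ∃ k : ℂ, ∀ z ∈ ball (0 : ℂ) 1, B z = k) ∧ f =ᵐ[arcMeasure] fun ζ => c * B ζ := by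
  -- Extremality turns a zero Garsia norm into `f = 0` a.e., written as `0` times the nonconstant
  -- Blaschke product `z`.
  by_cases h0 : garsiaNorm f = 0
  · have hf0 : f =ᵐ[arcMeasure] 0 :=
      (eLpNorm_eq_zero_iff hG.1.1 ENNReal.top_ne_zero).1 (hG.2 ▸ h0)
    refine ⟨0, _, isFiniteBlaschkeProduct_id, ?_, ?_⟩
    · rintro ⟨k, hk⟩
      have h1 := hk 0 (mem_ball_self one_pos)
      have h2 := hk (1 / 2) (by rw [mem_ball_zero_iff]; norm_num)
      rw [← h1] at h2
      norm_num at h2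
    · filter_upwards [hf0] with ζ hζ
      simpa using hζ
  obtain ⟨z₁, hz₁, hpos⟩ := exists_oscillation_pos h0
  obtain ⟨c, I, hI, hzero, hfI⟩ := exists_inner_of_normAttaining
    ⟨mem_BMOna_of_mem_VMO hf.1.1 hz₁ hpos, hf.2⟩ hG
  have hc : c ≠ 0 := by
    rintro rfl
    rw [oscillation_congr_ae hfI, oscillation_const_mul_of_norm_eq_one 0 hI.2 hz₁] at hpos
    simp at hpos
  obtain ⟨d, B, hB, hnc, hIB⟩ := exists_finiteBlaschkeProduct_of_inner hI hzero
    (tendsto_norm_poissonIntegral_of_mem_VMO hc hI.2 hfI hf.1.1)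
  refine ⟨c * d, B, hB, hnc, ?_⟩
  filter_upwards [hfI, hIB] with ζ h1 h2
  rw [h1, h2, mul_assoc]

lemma mem_QA_of_finiteBlaschkeProduct {f : Circle → ℂ} {c : ℂ} {B : ℂ → ℂ}
    (hB : IsFiniteBlaschkeProduct B) (hnc : ¬ ∃ k : ℂ, ∀ z ∈ ball (0 : ℂ) 1, B z = k)
    (hf : f =ᵐ[arcMeasure] fun ζ => c * B ζ) : f ∈ QA ∧ IsGExtremal f := by
  obtain ⟨n, a, ha, rfl⟩ := hB
  have hI := isInner_finiteBlaschkeProduct ha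
  have hP : ∀ z ∈ ball (0 : ℂ) 1, poissonIntegral
      (fun ζ : Circle => ∏ j, blaschkeFactor (a j) ζ) z = ∏ j, blaschkeFactor (a j) z :=
    fun z hz => poissonIntegral_diffContOnCl (diffContOnCl_prod_blaschkeFactor ha) hz
  have hzero : ∃ z ∈ ball (0 : ℂ) 1,
      poissonIntegral (fun ζ : Circle => ∏ j, blaschkeFactor (a j) ζ) z = 0 := by
    -- Nonconstancy excludes the empty product, so there is a first factor, and its zero is a zero
    -- of the product.
    obtain _ | n := n
    · exact absurd ⟨1, fun z _ => by simp⟩ hnc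
    · refine ⟨a 0, ha 0, ?_⟩
      rw [hP _ (ha 0)]
      exact Finset.prod_eq_zero (Finset.mem_univ 0) (by simp [blaschkeFactor])
  obtain ⟨⟨hna, hH⟩, hG⟩ := normAttaining_of_inner hI hzero hf
  refine ⟨⟨⟨⟨hna.1, ?_⟩, hna.1.1, hH.2⟩, hH⟩, hG⟩
  have h1 := (((tendsto_norm_prod_blaschkeFactor ha).pow 2).const_sub 1).const_mul (‖c‖ ^ 2)
  rw [one_pow, sub_self, mul_zero] at h1
  refine h1.congr' ?_
  filter_upwards [eventually_boundary_mem_ball] with z hz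
  rw [oscillation_congr_ae hf, oscillation_const_mul_of_norm_eq_one c hI.2 hz, hP z hz]

end Garsia

theorem mainTheorem9 :
    (∀ f : Circle → ℂ,
      (f ∈ Garsia.BMOna ∩ Garsia.Hardy ∞ ∧ Garsia.IsGExtremal f) ↔
        ∃ (c : ℂ) (I : Circle → ℂ), Garsia.IsInner I ∧
          (∃ z ∈ ball (0 : ℂ) 1, Garsia.poissonIntegral I z = 0) ∧
          f =ᵐ[Garsia.arcMeasure] fun ζ => c * I ζ) ∧
    (∀ f : Circle → ℂ,
      (f ∈ Garsia.QA ∧ Garsia.IsGExtremal f) ↔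
        ∃ (c : ℂ) (B : ℂ → ℂ), Garsia.IsFiniteBlaschkeProduct B ∧
          (¬ ∃ k : ℂ, ∀ z ∈ ball (0 : ℂ) 1, B z = k) ∧
          f =ᵐ[Garsia.arcMeasure] fun ζ => c * B ζ) := by
  refine ⟨fun f => ⟨fun h => Garsia.exists_inner_of_normAttaining h.1 h.2, ?_⟩,
    fun f => ⟨fun h => Garsia.exists_finiteBlaschkeProduct_of_mem_QA h.1 h.2, ?_⟩⟩
  · rintro ⟨c, I, hI, hzero, hf⟩
    exact Garsia.normAttaining_of_inner hI hzero hf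
  · rintro ⟨c, B, hB, hnc, hf⟩
    exact Garsia.mem_QA_of_finiteBlaschkeProduct hB hnc hf
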